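/- Let $d,k,t$ be positive integers. A finite simple graph $G$ satisfies property $\mathcal P(d,k,t)$ if every vertex has degree at least $d$ and, for any two vertices $u,v$, the number of paths (without repeated vertices) of length $k$ from $u$ to $v$ is at most $d^{1/4}$ and the number of paths of length $k+1$ from $u$ to $v$ is at most $d^{k+1}/t$ (length = number of edges). Consider the following randomized algorithm, which tries to embed a tree $T$ with an arbitrary chosen root $r$ into $G$. Start at an arbitrary vertex $v_0$ of $G$ and make $k$ random moves, each to a uniformly random neighbor of the current vertex; embed $r$ at the final position $v_k$. As long as $T$ is not completely embedded, take an arbitrary vertex $u$ of $T$ that is embedded, at $f(u)$ say, while its children are not. If $f(u)$ has at least as many neighbors unoccupied by vertices of $T$ as $u$ has children, embed the children of $u$ one by one, in an arbitrary order, each at a uniformly random currently unoccupied neighbor of $f(u)$; otherwise, fail. The arbitrary choices made during the run may depend on the history of the run. Theorem. For every $\eta>0$ there is $n_0$, depending only on $\eta$, such that the following holds for every $n\ge n_0$. Let $G$ be a graph on $n$ vertices satisfying $\mathcal P(d,k,t)$, where $d\ge \log^8 n$ and $k\le \log n$ (natural logarithm), and let $\varepsilon,\delta>0$ be real numbers with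 $$(2k\varepsilon)^{1/k}+\delta+\frac1k\le 1 .$$ Then for every tree $T$ of maximum degree at most $\delta d$ and with at most $\varepsilon t$ vertices, and for all arbitrary choices in the algorithm (the root $r$, the start vertex $v_0$, and the order of processing), the algorithm finds an embedding of $T$ in $G$, that is, an injective map from the vertices of $T$ to those of $G$ that sends edges to edges, with probability at least $1-\eta$. -/

import Mathlib

namespace TreeEmbedding

/-! ### Graphs with few paths between any two vertices -/

/-- The number of (self-avoiding) paths with `k` edges from `u` to `v`. -/
noncomputable def numPaths {V : Type*} (G : SimpleGraph V) (k : ℕ) (u v : V) : ℕ :=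
  {p : G.Walk u v | p.IsPath ∧ p.length = k}.ncard

open scoped Classical in
/-- Property `P(d, k, t)` for positive integers `d`, `k`, `t`: minimum degree at least `d`, at most
`d ^ (1/4)` paths of length `k`, and at most `d ^ (k+1) / t` paths of length `k + 1`, between any
two vertices. -/
structure PropertyP {V : Type*} [Fintype V] (G : SimpleGraph V) (d k t : ℕ) : Prop where
  d_pos : 0 < d
  k_pos : 0 < k
  t_pos : 0 < t
  le_degree : ∀ v : V, d ≤ G.degree v
  paths_le : ∀ u v : V, (numPaths G k u v : ℝ) ≤ (d : ℝ) ^ (1 / 4 : ℝ)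
  paths_succ_le : ∀ u v : V, (numPaths G (k + 1) u v : ℝ) ≤ (d : ℝ) ^ (k + 1) / (t : ℝ)

/-! ### Rooted trees, partial embeddings and processing orders -/

/-- In the tree `T` rooted at `r`, the vertex `w` is a child of `u`: it is a neighbour of `u`
one level further away from the root. -/
def IsChild {W : Type*} (T : SimpleGraph W) (r u w : W) : Prop :=
  T.Adj u w ∧ T.dist r w = T.dist r u + 1

/-- With respect to the partial embedding `f` (where `f w = none` means that `w` is not embedded
yet), the vertex `u` is embedded, it has children, and its children are not embedded. -/
def Ready {V W : Type*} (T : SimpleGraph W) (r : W) (f : W → Option V) (u : W) : Prop :=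
  f u ≠ none ∧ (∃ w, IsChild T r u w) ∧ ∀ w, IsChild T r u w → f w = none

/-- A way to resolve the arbitrary choices of the algorithm: which embedded vertex with unembedded
children is processed next, and in which order its children are embedded. These choices may depend
on the whole history, which is given by the positions `past` of the initial random walk before its
last one, and by the current partial embedding `f` (together they determine all earlier steps). -/
structure Schedule {W : Type*} (T : SimpleGraph W) (r : W) (V : Type*) where
  next : List V → (W → Option V) → W
  order : List V → (W → Option V) → List W
  next_ready : ∀ past f, (∃ u, Ready T r f u) → Ready T r f (next past f)
  order_nodup : ∀ past f, (order past f).Nodup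
  mem_order : ∀ past f w, w ∈ order past f ↔ IsChild T r (next past f) w

/-! ### The randomized algorithm

A random computation that may fail is a probability mass function on an `Option` type; the value
`none` is failure. -/

/-- Sequential composition of random computations that may fail. -/
noncomputable def andThen {α β : Type*} (p : PMF (Option α)) (g : α → PMF (Option β)) :
    PMF (Option β) :=
  p.bind fun o => match o with
    | none => PMF.pure none
    | some a => g a

open scoped Classical in
/-- A uniformly random element of the finite set `s`; failure if `s` is empty. -/
noncomputable def pick {V : Type*} (s : Finset V) : PMF (Option V) :=
  if h : s.Nonempty then (PMF.uniformOfFinset s h).map some else PMF.pure none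

open scoped Classical in
/-- The neighbours of the vertex `p` that are not occupied by the partial embedding `f`. -/
noncomputable def available {V W : Type*} [Fintype V] (G : SimpleGraph V)
    (f : W → Option V) (p : V) : Finset V :=
  {v | G.Adj p v ∧ ∀ w, f w ≠ some v}

open scoped Classical in
/-- `k` random moves starting from `v`, each one to a uniformly random neighbour of the current
vertex. The result is the list of all positions but the last (appended to `past`), and the last
position. -/
noncomputable def randomMoves {V : Type*} [Fintype V] (G : SimpleGraph V) :
    ℕ → List V → V → PMF (Option (List V × V))
  | 0, past, v => PMF.pure (some (past, v))
  | k + 1, past, v => andThen (pick (G.neighborFinset v)) fun v' =>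
      randomMoves G k (past ++ [v]) v'

open scoped Classical in
/-- Embed the tree vertices in the list one by one, each at a uniformly random vertex among the
neighbours of `p` that are unoccupied at that moment. -/
noncomputable def embedList {V W : Type*} [Fintype V] (G : SimpleGraph V) (p : V) :
    List W → (W → Option V) → PMF (Option (W → Option V))
  | [], f => PMF.pure (some f)
  | w :: ws, f => andThen (pick (available G f p)) fun v =>
      embedList G p ws (Function.update f w (some v))

/-- One round: take the next tree vertex `u`, sitting at `p = f u`. If `p` has enough available
neighbours, embed the children of `u` one by one; otherwise fail. -/
noncomputable def processNext {V W : Type*} [Fintype V] (G : SimpleGraph V) {T : SimpleGraph W}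
    {r : W} (σ : Schedule T r V) (past : List V) (f : W → Option V) :
    PMF (Option (W → Option V)) :=
  match f (σ.next past f) with
  | none => PMF.pure none
  | some p =>
      if (σ.order past f).length ≤ (available G f p).card then
        embedList G p (σ.order past f) f
      else PMF.pure none

open scoped Classical in
/-- Repeat the rounds as long as the tree is not completely embedded, at most `m` times. -/
noncomputable def rounds {V W : Type*} [Fintype V] (G : SimpleGraph V) {T : SimpleGraph W}
    {r : W} (σ : Schedule T r V) (past : List V) :
    ℕ → (W → Option V) → PMF (Option (W → Option V))
  | 0, f => PMF.pure (some f)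
  | m + 1, f =>
      if ∀ w, f w ≠ none then PMF.pure (some f)
      else andThen (processNext G σ past f) fun g => rounds G σ past m g

open scoped Classical in
/-- The self-avoiding tree-indexed random walk: make `k` random moves from `v₀`, embed the root `r`
of `T` at the final position, and then embed the children of embedded vertices at random, in the
order given by `σ`. Each round embeds at least one further vertex, so as many rounds as `T` has
vertices are enough. -/
noncomputable def randomEmbedding {V W : Type*} [Fintype V] [Fintype W] (G : SimpleGraph V)
    {T : SimpleGraph W} {r : W} (σ : Schedule T r V) (k : ℕ) (v₀ : V) :
    PMF (Option (W → Option V)) :=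
  andThen (randomMoves G k [] v₀) fun x =>
    rounds G σ x.1 (Fintype.card W) fun w => if w = r then some x.2 else none

/-- The result of the algorithm is an embedding of `T` in `G`: an injective map defined on all
vertices of `T` that sends edges to edges. -/
def IsEmbedding {V W : Type*} (T : SimpleGraph W) (G : SimpleGraph V)
    (o : Option (W → Option V)) : Prop :=
  ∃ φ : W → V, o = some (fun w => some (φ w)) ∧ Function.Injective φ ∧
    ∀ a b, T.Adj a b → G.Adj (φ a) (φ b)

/-- The probability that the algorithm finds an embedding of `T` in `G`. -/
noncomputable def successProb {V W : Type*} [Fintype V] [Fintype W] (G : SimpleGraph V)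
    {T : SimpleGraph W} {r : W} (σ : Schedule T r V) (k : ℕ) (v₀ : V) : ENNReal :=
  (randomEmbedding G σ k v₀).toOuterMeasure {o | IsEmbedding T G o}

end TreeEmbedding

namespace TreeEmbedding

/-! ### Parents in rooted trees -/

/-! Put α = (2kε)^(1/k), A = αd, N = ⌊d^(1/4)⌋ and q = d/(2kεt). The algorithm can fail only at a
vertex x = f(u) too many of whose neighbours are occupied while no child of u is embedded; call x
closed once such a child is embedded. The degree budget is δd for children, αd to keep every random
choice among at least A vertices, and d/k for occupied neighbours. So it suffices that a vertex that
is not closed has at most d/k occupied neighbours.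

Fix v. Tree vertices of depth below k contribute at most N per level, deterministically, since they
give distinct paths of length at most k from f(r) to v. For a deeper w, once its k-th ancestor sits
at x, the chance of landing next to v is at most (number of (k+1)-paths from x to v)/A^k ≤
d^(k+1)/(t A^k) = q. Hence the expected contribution is at most q|T| ≤ d/(2k).

For concentration, group the deep vertices by their (k-1)-st ancestor c. A group contributes at most
N, because it gives distinct k-paths from f(c) to v. Sort the groups by the level of c modulo k:
within one residue class, embedding a vertex b affects only one group, so the product of the factors
1 + κ·`load` is a supermartingale (`Step.sum_potential_update`). Its initial value is at most
exp(κ·expectation) (`potential_initial_le`), and it dominates the exponential of the number of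
occupants (`Coherent.exp_le_potential`).

Summing over v and residues, with coefficients exp(-κ(1-κN)τ), gives one function of the partial
embedding. Below 1 it excludes failure in the next round (`Coherent.card_occupants_le`); at 1 or
above it is trivially a bound on the failure probability. Induction over the rounds bounds the
failure probability by it throughout (`Controlled.rounds_le`), and `exponent_bound` makes its
initial value small. -/

theorem exists_parent {W : Type*} {T : SimpleGraph W} (hT : T.IsTree) (r : W) :
    ∃ par : W → W, ∀ u w, IsChild T r u w ↔ w ≠ r ∧ par w = u := by
  choose p hp hlen using fun w => hT.connected.exists_path_of_dist r w
  refine ⟨fun w => (p w).penultimate, fun u w => ⟨fun h => ?_, ?_⟩⟩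
  · have hr : w ≠ r := by
      rintro rfl
      have := h.2
      simp at this
    refine ⟨hr, ?_⟩
    -- Paths in a tree are unique, so the path to a child is the path to its parent plus one edge.
    have hq : ((p u).concat h.1).IsPath := by
      apply SimpleGraph.Walk.isPath_of_length_eq_dist
      rw [SimpleGraph.Walk.length_concat, hlen, h.2]
    change (p w).penultimate = u
    rw [(hT.existsUnique_path r w).unique (hp w) hq, SimpleGraph.Walk.penultimate_concat]
  · rintro ⟨hr, rfl⟩
    have hn : ¬ (p w).Nil := SimpleGraph.Walk.not_nil_of_ne hr.symm
    have hadj := (p w).adj_penultimate hn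
    have h1 : T.dist r (p w).penultimate ≤ (p w).dropLast.length := SimpleGraph.dist_le _
    have h2 : 0 < (p w).length := by
      rw [Nat.pos_iff_ne_zero, Ne, SimpleGraph.Walk.length_eq_zero_iff]
      exact hn
    have h3 : (p w).dropLast.length = (p w).length - 1 := by
      simp [SimpleGraph.Walk.dropLast, SimpleGraph.Walk.take_length]
    refine ⟨hadj, ?_⟩
    rcases hT.dist_eq_dist_add_one_of_adj r hadj with h | h
    · rw [h3, hlen] at h1
      omega
    · exact h

/-- `par` sends every vertex but `r` to its parent in the tree `T` rooted at `r`. -/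
def IsParentMap {W : Type*} (T : SimpleGraph W) (r : W) (par : W → W) : Prop :=
  ∀ u w, IsChild T r u w ↔ w ≠ r ∧ par w = u

section Parent

variable {W : Type*} {T : SimpleGraph W} {r : W} {par : W → W}

theorem IsParentMap.isChild (hpar : IsParentMap T r par) {w : W} (hw : w ≠ r) :
    IsChild T r (par w) w :=
  (hpar _ _).2 ⟨hw, rfl⟩

theorem IsParentMap.dist_iterate (hpar : IsParentMap T r par) (j : ℕ) (w : W)
    (hj : j ≤ T.dist r w) : T.dist r (par^[j] w) + j = T.dist r w := by
  induction j generalizing w with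
  | zero => simp
  | succ j ih =>
    have hw : w ≠ r := by
      rintro rfl
      simp at hj
    have h := (hpar.isChild hw).2
    rw [Function.iterate_succ_apply]
    have := ih (par w) (by omega)
    omega

theorem IsParentMap.iterate_dist (hT : T.IsTree) (hpar : IsParentMap T r par) (w : W) :
    par^[T.dist r w] w = r := by
  have h := hpar.dist_iterate (T.dist r w) w le_rfl
  have h0 : T.dist r (par^[T.dist r w] w) = 0 := by omega
  exact (hT.connected.dist_eq_zero_iff.1 h0).symm

end Parent

/-! ### Counting paths -/

section Paths

variable {V : Type*} [Fintype V] {G : SimpleGraph V}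

theorem finite_walks (G : SimpleGraph V) (m : ℕ) (x v : V) :
    {p : G.Walk x v | p.length = m}.Finite := by
  classical
  exact Set.toFinite _

/-- The number of paths with `m` edges from `x` to `v` on which no vertex but possibly the first
one lies in `S`. -/
noncomputable def pathsAvoiding (G : SimpleGraph V) (S : Set V) (m : ℕ) (x v : V) : ℕ :=
  {p : G.Walk x v | p.IsPath ∧ p.length = m ∧ ∀ z ∈ p.support.tail, z ∉ S}.ncard

theorem pathsAvoiding_anti {S S' : Set V} (h : S ⊆ S') (m : ℕ) (x v : V) :
    pathsAvoiding G S' m x v ≤ pathsAvoiding G S m x v := by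
  apply Set.ncard_le_ncard
  · exact fun p hp => ⟨hp.1, hp.2.1, fun z hz hzS => hp.2.2 z hz (h hzS)⟩
  · exact (finite_walks G m x v).subset fun p hp => hp.2.1

theorem pathsAvoiding_le_numPaths (S : Set V) (m : ℕ) (x v : V) :
    pathsAvoiding G S m x v ≤ numPaths G m x v := by
  apply Set.ncard_le_ncard
  · exact fun p hp => ⟨hp.1, hp.2.1⟩
  · exact (finite_walks G m x v).subset fun p hp => hp.2

theorem one_le_pathsAvoiding_one {S : Set V} {x v : V} (h : G.Adj x v) (hv : v ∉ S) :
    1 ≤ pathsAvoiding G S 1 x v := by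
  rw [Nat.one_le_iff_ne_zero, pathsAvoiding, ← Nat.pos_iff_ne_zero, Set.ncard_pos
    ((finite_walks G 1 x v).subset fun p hp => hp.2.1)]
  refine ⟨SimpleGraph.Walk.cons h .nil, ?_, rfl, ?_⟩
  · simp [h.ne]
  · simpa using hv

/-- Prefix each path with the edge from x to y. It stays a path because x lies in S', which the rest
avoids. The first vertex is exempt from avoidance because x may already be closed while further
children are placed next to it. -/
theorem sum_pathsAvoiding_le {S S' : Set V} (hS : S ⊆ S') {x : V} (hx : x ∈ S') (s : Finset V)
    (hs : ∀ y ∈ s, G.Adj x y ∧ y ∉ S) (m : ℕ) (v : V) :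
    ∑ y ∈ s, pathsAvoiding G S' m y v ≤ pathsAvoiding G S (m + 1) x v := by
  classical
  have hfin : ∀ (R : Set V) (l : ℕ) (y : V),
      {p : G.Walk y v | p.IsPath ∧ p.length = l ∧ ∀ z ∈ p.support.tail, z ∉ R}.Finite :=
    fun R l y => (finite_walks G l y v).subset fun p hp => hp.2.1
  simp only [pathsAvoiding, Set.ncard_eq_toFinset_card _ (hfin _ _ _)]
  rw [← Finset.sum_attach, ← Finset.card_sigma]
  apply Finset.card_le_card_of_injOn
    (fun a : (Σ y : {y // y ∈ s}, G.Walk y.1 v) => SimpleGraph.Walk.cons (hs a.1.1 a.1.2).1 a.2)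
  · rintro ⟨⟨y, hy⟩, p⟩ hp
    simp only [Finset.coe_sigma, Set.mem_sigma_iff, Finset.mem_coe, Finset.mem_attach, true_and,
      Set.Finite.mem_toFinset, Set.mem_ofPred_eq] at hp
    simp only [Finset.mem_coe, Set.Finite.mem_toFinset, Set.mem_ofPred_eq]
    obtain ⟨h1, h2, h3⟩ := hp
    have hmem : ∀ z ∈ p.support, z = y ∨ z ∈ p.support.tail := fun z hz =>
      (SimpleGraph.Walk.mem_support_iff p).1 hz
    refine ⟨?_, by simp [h2], fun z hz => ?_⟩
    · rw [SimpleGraph.Walk.cons_isPath_iff]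
      refine ⟨h1, fun hxp => ?_⟩
      rcases hmem x hxp with h | h
      · exact (hs y hy).1.ne h
      · exact h3 x h hx
    · rw [SimpleGraph.Walk.support_cons, List.tail_cons] at hz
      rcases hmem z hz with rfl | h
      · exact (hs _ hy).2
      · exact fun hzS => h3 z h (hS hzS)
  · rintro ⟨⟨y, hy⟩, p⟩ _ ⟨⟨y', hy'⟩, p'⟩ _ h
    simp only [SimpleGraph.Walk.cons.injEq] at h
    obtain ⟨rfl, h⟩ := h
    simp only [heq_eq_eq] at h
    rw [h]

/-- Many paths of length `m` with common ends can be prolonged by one common edge. -/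
theorem exists_lt_numPaths_succ {d : ℕ} (m N : ℕ) (x v : V) (hd : (N + 1) * (m + 1) < d)
    (hdeg : d ≤ (G.neighborSet v).ncard) (h : N < numPaths G m x v) :
    ∃ v', N < numPaths G (m + 1) x v' := by
  classical
  have hfin : {p : G.Walk x v | p.IsPath ∧ p.length = m}.Finite :=
    (finite_walks G m x v).subset fun p hp => hp.2
  rw [numPaths, Set.ncard_eq_toFinset_card _ hfin] at h
  obtain ⟨F, hF, hcard⟩ := Finset.exists_subset_card_eq (Nat.succ_le_of_lt h)
  have hF' : ∀ p ∈ F, p.IsPath ∧ p.length = m := fun p hp => by simpa using hF hp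
  -- All vertices on N + 1 chosen paths; the degree of v exceeds their number, so some neighbour of
  -- v prolongs every chosen path.
  let S : Finset V := F.biUnion fun p => p.support.toFinset
  have hS : S.card ≤ (N + 1) * (m + 1) := by
    refine (Finset.card_biUnion_le_card_mul F _ (m + 1) fun p hp => ?_).trans_eq (by rw [hcard])
    refine (List.toFinset_card_le _).trans ?_
    rw [SimpleGraph.Walk.length_support, (hF' p hp).2]
  obtain ⟨v', hv', hv'S⟩ : ∃ v' ∈ G.neighborSet v, v' ∉ (S : Set V) := by
    apply Set.exists_mem_notMem_of_ncard_lt_ncard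
    · rw [Set.ncard_coe_finset]
      omega
    · exact S.finite_toSet
  have hadj : G.Adj v v' := hv'
  refine ⟨v', ?_⟩
  rw [Nat.lt_iff_add_one_le, ← Nat.succ_eq_add_one, ← hcard, ← Set.ncard_coe_finset]
  apply Set.ncard_le_ncard_of_injOn (fun p => p.concat hadj)
    (ht := (finite_walks G (m + 1) x v').subset fun p hp => hp.2)
  · intro p hp
    refine ⟨(hF' p hp).1.concat (fun hmem => hv'S ?_) hadj, ?_⟩
    · exact Finset.mem_coe.2 (Finset.mem_biUnion.2 ⟨p, hp, by simpa using hmem⟩)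
    · rw [SimpleGraph.Walk.length_concat, (hF' p hp).2]
  · intro p _ q _ hpq
    simpa using SimpleGraph.Walk.concat_inj hpq

/-- More than N paths of length j < k could be prolonged edge by edge, keeping common ends, to more
than N paths of length k. The shorter lengths are needed for the levels near the root. -/
theorem numPaths_le_of_le {d k N : ℕ} (hd : (N + 1) * (k + 1) < d)
    (hdeg : ∀ v, d ≤ (G.neighborSet v).ncard) (hk : ∀ u v, numPaths G k u v ≤ N) {j : ℕ}
    (hj : j ≤ k) (u v : V) : numPaths G j u v ≤ N := by
  induction hj using Nat.decreasingInduction generalizing v with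
  | self => exact hk u v
  | of_succ j hj ih =>
    by_contra! hlt
    obtain ⟨v', hv'⟩ := exists_lt_numPaths_succ j N u v
      (lt_of_le_of_lt (Nat.mul_le_mul_left _ (by omega)) hd) (hdeg v) hlt
    exact absurd (ih v') (by omega)

end Paths

/-! ### The potential of a partial embedding -/

section Potential

variable {V W : Type*}

/-- The vertices whose tree vertex already has an embedded child. -/
def closedVertices (T : SimpleGraph W) (r : W) (f : W → Option V) : Set V :=
  {z | ∃ u w, IsChild T r u w ∧ f u = some z ∧ f w ≠ none}

/-- A bound for the conditional probability that `w` lands on a neighbour of `v` before `v` is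
closed. If the lowest embedded vertex among the first `i + 1` ancestors of `w` is the `j`-th one,
at `x`, then it is the number of paths of length `m + j + 1` from `x` to `v` that avoid the closed
vertices, divided by `A ^ (m + j)`; if there is none, it is `q`. -/
noncomputable def weight (G : SimpleGraph V) (T : SimpleGraph W) (r : W) (par : W → W) (A q : ℝ)
    (v : V) (f : W → Option V) : ℕ → ℕ → W → ℝ
  | 0, m, w => match f w with
    | some x => pathsAvoiding G (closedVertices T r f) (m + 1) x v / A ^ m
    | none => q
  | i + 1, m, w => match f w with
    | some x => pathsAvoiding G (closedVertices T r f) (m + 1) x v / A ^ m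
    | none => weight G T r par A q v f i (m + 1) (par w)

open scoped Classical in
/-- The sum of the weights of the vertices `k - 1` levels below `c`. -/
noncomputable def load [Fintype W] (G : SimpleGraph V) (T : SimpleGraph W) (r : W) (par : W → W)
    (A q : ℝ) (k : ℕ) (v : V) (c : W) (f : W → Option V) : ℝ :=
  ∑ w with k ≤ T.dist r w ∧ par^[k - 1] w = c, weight G T r par A q v f (k - 1) 0 w

open scoped Classical in
/-- The exponential potential of `v` for the levels that are congruent to `a` modulo `k`. -/
noncomputable def potential [Fintype W] (G : SimpleGraph V) (T : SimpleGraph W) (r : W)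
    (par : W → W) (A q κ : ℝ) (k : ℕ) (v : V) (a : ℕ) (f : W → Option V) : ℝ :=
  ∏ c with T.dist r c % k = a, (1 + κ * load G T r par A q k v c f)

/-- The weighted sum of all potentials. -/
noncomputable def totalPotential [Fintype V] [Fintype W] (G : SimpleGraph V)
    (T : SimpleGraph W) (r : W) (par : W → W) (A q κ : ℝ) (k : ℕ) (coef : ℕ → ℝ)
    (f : W → Option V) : ℝ :=
  ∑ v, ∑ a ∈ Finset.range k, coef a * potential G T r par A q κ k v a f

variable {G : SimpleGraph V} {T : SimpleGraph W} {r : W} {par : W → W} {A q κ : ℝ} {v : V}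
  {f : W → Option V}

theorem weight_of_some {w : W} {x : V} (h : f w = some x) (i m : ℕ) :
    weight G T r par A q v f i m w =
      pathsAvoiding G (closedVertices T r f) (m + 1) x v / A ^ m := by
  cases i <;> simp [weight, h]

theorem weight_zero_of_none {w : W} (h : f w = none) (m : ℕ) :
    weight G T r par A q v f 0 m w = q := by
  simp [weight, h]

theorem weight_succ_of_none {w : W} (h : f w = none) (i m : ℕ) :
    weight G T r par A q v f (i + 1) m w = weight G T r par A q v f i (m + 1) (par w) := by
  simp [weight, h]

theorem weight_nonneg (hA : 0 < A) (hq : 0 ≤ q) (i m : ℕ) (w : W) :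
    0 ≤ weight G T r par A q v f i m w := by
  induction i generalizing m w with
  | zero =>
    cases h : f w with
    | none => rwa [weight_zero_of_none h]
    | some x => rw [weight_of_some h]; positivity
  | succ i ih =>
    cases h : f w with
    | none => rw [weight_succ_of_none h]; exact ih _ _
    | some x => rw [weight_of_some h]; positivity

theorem load_nonneg [Fintype W] (hA : 0 < A) (hq : 0 ≤ q) (k : ℕ) (c : W) :
    0 ≤ load G T r par A q k v c f :=
  Finset.sum_nonneg fun _ _ => weight_nonneg hA hq _ _ _

theorem one_le_load_factor [Fintype W] (hA : 0 < A) (hq : 0 ≤ q) (hκ : 0 ≤ κ) (k : ℕ) (c : W) :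
    1 ≤ 1 + κ * load G T r par A q k v c f :=
  le_add_of_nonneg_right (mul_nonneg hκ (load_nonneg hA hq k c))

theorem potential_nonneg [Fintype W] (hA : 0 < A) (hq : 0 ≤ q) (hκ : 0 ≤ κ) (k a : ℕ) :
    0 ≤ potential G T r par A q κ k v a f :=
  Finset.prod_nonneg fun c _ => zero_le_one.trans (one_le_load_factor hA hq hκ k c)

theorem totalPotential_nonneg [Fintype V] [Fintype W] (hA : 0 < A) (hq : 0 ≤ q) (hκ : 0 ≤ κ)
    (k : ℕ) {coef : ℕ → ℝ} (hc : ∀ a, 0 ≤ coef a) : 0 ≤ totalPotential G T r par A q κ k coef f :=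
  Finset.sum_nonneg fun _ _ => Finset.sum_nonneg fun a _ =>
    mul_nonneg (hc a) (potential_nonneg hA hq hκ k a)

end Potential

/-! ### Embedding one more vertex -/

section Step

variable {V W : Type*} [DecidableEq W] {G : SimpleGraph V} {T : SimpleGraph W} {r : W}
  {par : W → W} {A q κ : ℝ} {v : V} {f : W → Option V}

theorem closedVertices_subset_update {b : W} (hb : f b = none) (y : V) :
    closedVertices T r f ⊆ closedVertices T r (Function.update f b (some y)) := by
  rintro z ⟨u, w, huw, hu, hw⟩
  have h1 : u ≠ b := by rintro rfl; simp [hb] at hu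
  have h2 : w ≠ b := by rintro rfl; exact hw hb
  exact ⟨u, w, huw, by rwa [Function.update_of_ne h1], by rwa [Function.update_of_ne h2]⟩

/-- The situation in which the vertex `b`, whose parent sits at `x`, is about to be embedded at a
random element of `s`. -/
structure Step (G : SimpleGraph V) (T : SimpleGraph W) (r : W) (par : W → W) (A q : ℝ) (k : ℕ)
    (f : W → Option V) (b : W) (x : V) (s : Finset V) : Prop where
  parent : IsParentMap T r par
  ne_root : b ≠ r
  pos : 0 < A
  nonneg : 0 ≤ q
  k_pos : 0 < k
  paths_le : ∀ x v, (numPaths G (k + 1) x v : ℝ) ≤ q * A ^ k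
  unembedded : f b = none
  embedded : f (par b) = some x
  adj : ∀ y ∈ s, G.Adj x y
  unoccupied : ∀ y ∈ s, ∀ w, f w ≠ some y
  le_card : A ≤ s.card

variable {k : ℕ} {b : W} {x : V} {s : Finset V}

theorem Step.sum_pathsAvoiding [Fintype V] (h : Step G T r par A q k f b x s) (m : ℕ) :
    ∑ y ∈ s, (pathsAvoiding G (closedVertices T r (Function.update f b (some y))) m y v : ℝ) ≤
      pathsAvoiding G (closedVertices T r f) (m + 1) x v := by
  have hb : par b ≠ b := fun e => by
    have := h.embedded
    rw [e, h.unembedded] at this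
    simp at this
  -- Placing b closes x, the position of its parent; this is what lets the counted paths be
  -- prolonged back to x.
  have hsub : ∀ y, insert x (closedVertices T r f) ⊆
      closedVertices T r (Function.update f b (some y)) := fun y => by
    refine Set.insert_subset ?_ (closedVertices_subset_update h.unembedded y)
    exact ⟨par b, b, h.parent.isChild h.ne_root, by rw [Function.update_of_ne hb, h.embedded],
      by simp⟩
  refine le_trans ?_ (Nat.cast_le.2 (sum_pathsAvoiding_le (Set.subset_insert x _)
    (Set.mem_insert x _) s (fun y hy => ⟨h.adj y hy, ?_⟩) m v))
  · rw [Nat.cast_sum]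
    exact Finset.sum_le_sum fun y _ => Nat.cast_le.2 (pathsAvoiding_anti (hsub y) m y v)
  · rintro ⟨u, w, _, hu, _⟩
    exact h.unoccupied y hy u hu

theorem Step.sum_weight_update_self [Fintype V] (h : Step G T r par A q k f b x s) (v : V)
    (i m : ℕ) (him : i + m + 1 = k) :
    ∑ y ∈ s, weight G T r par A q v (Function.update f b (some y)) i m b ≤
      s.card * weight G T r par A q v f i m b := by
  have hA := h.pos
  have h1 : ∀ y, weight G T r par A q v (Function.update f b (some y)) i m b =
      pathsAvoiding G (closedVertices T r (Function.update f b (some y))) (m + 1) y v / A ^ m :=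
    fun y => weight_of_some (by simp) _ _
  have h2 : pathsAvoiding G (closedVertices T r f) (m + 1 + 1) x v / A ^ m ≤
      A * weight G T r par A q v f i m b := by
    cases i with
    | zero =>
      -- Here b is the topmost ancestor looked at and the weight is still q; with m + 1 = k this is
      -- the only place where the bound on paths of length k + 1 enters.
      rw [weight_zero_of_none h.unembedded, div_le_iff₀ (by positivity)]
      obtain rfl : k = m + 1 := by omega
      have := (Nat.cast_le.2 (pathsAvoiding_le_numPaths (G := G) (closedVertices T r f)
        (m + 1 + 1) x v)).trans (h.paths_le x v)
      exact this.trans_eq (by ring)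
    | succ i =>
      rw [weight_succ_of_none h.unembedded, weight_of_some h.embedded]
      apply le_of_eq
      field_simp
      ring
  simp only [h1]
  rw [← Finset.sum_div]
  refine (div_le_div_of_nonneg_right (h.sum_pathsAvoiding (m + 1)) (by positivity)).trans
    (h2.trans ?_)
  exact mul_le_mul_of_nonneg_right h.le_card (weight_nonneg hA h.nonneg _ _ _)

/-- If b is not met while climbing from w, only the set of closed vertices changes; it grows, so the
weight cannot increase for any y. Otherwise the weight does not increase on average. -/
theorem Step.weight_update [Fintype V] (h : Step G T r par A q k f b x s) (v : V) (i m : ℕ)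
    (w : W) (him : i + m + 1 = k) :
    (∀ y, weight G T r par A q v (Function.update f b (some y)) i m w ≤
      weight G T r par A q v f i m w) ∨
    ∃ j ≤ i, par^[j] w = b ∧
      ∑ y ∈ s, weight G T r par A q v (Function.update f b (some y)) i m w ≤
        s.card * weight G T r par A q v f i m w := by
  have hA := h.pos
  induction i generalizing m w with
  | zero =>
    by_cases hwb : w = b
    · subst hwb
      exact Or.inr ⟨0, le_rfl, rfl, h.sum_weight_update_self v _ m him⟩
    · refine Or.inl fun y => ?_
      cases hw : f w with
      | some x' =>
        rw [weight_of_some hw, weight_of_some (x := x') (by rwa [Function.update_of_ne hwb])]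
        gcongr
        exact pathsAvoiding_anti (closedVertices_subset_update h.unembedded y) _ _ _
      | none =>
        rw [weight_zero_of_none hw, weight_zero_of_none (by rwa [Function.update_of_ne hwb])]
  | succ i ih =>
    by_cases hwb : w = b
    · subst hwb
      exact Or.inr ⟨0, Nat.zero_le _, rfl, h.sum_weight_update_self v _ m him⟩
    · cases hw : f w with
      | some x' =>
        refine Or.inl fun y => ?_
        rw [weight_of_some hw, weight_of_some (x := x') (by rwa [Function.update_of_ne hwb])]
        gcongr
        exact pathsAvoiding_anti (closedVertices_subset_update h.unembedded y) _ _ _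
      | none =>
        have hw' : ∀ y, Function.update f b (some y) w = none := fun y => by
          rwa [Function.update_of_ne hwb]
        simp only [weight_succ_of_none hw, weight_succ_of_none (hw' _)]
        rcases ih (m + 1) (par w) (by omega) with h1 | ⟨j, hj, hjb, h1⟩
        · exact Or.inl h1
        · exact Or.inr ⟨j + 1, by omega, by rwa [Function.iterate_succ_apply], h1⟩

theorem Step.sum_weight_update [Fintype V] (h : Step G T r par A q k f b x s) (v : V) (i m : ℕ)
    (w : W) (him : i + m + 1 = k) :
    ∑ y ∈ s, weight G T r par A q v (Function.update f b (some y)) i m w ≤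
        s.card * weight G T r par A q v f i m w := by
  rcases h.weight_update v i m w him with h1 | ⟨_, _, _, h1⟩
  · simpa using Finset.sum_le_sum fun y (_ : y ∈ s) => h1 y
  · exact h1

theorem Step.sum_load_update [Fintype V] [Fintype W] (h : Step G T r par A q k f b x s) (v : V)
    (c : W) :
    ∑ y ∈ s, load G T r par A q k v c (Function.update f b (some y)) ≤
      s.card * load G T r par A q k v c f := by
  have := h.k_pos
  simp only [load]
  rw [Finset.sum_comm, Finset.mul_sum]
  exact Finset.sum_le_sum fun w _ => h.sum_weight_update v _ _ w (by omega)

/-- The group of c can grow only if b lies fewer than k levels below c. The depth condition in `hc`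
is there because `par r` is arbitrary: iterates that pass the root carry no meaning. -/
theorem Step.load_update_le [Fintype V] [Fintype W] (h : Step G T r par A q k f b x s) (v : V)
    (c : W) (hc : ∀ i < k, par^[i] b = c → T.dist r c + i ≠ T.dist r b) (y : V) :
    load G T r par A q k v c (Function.update f b (some y)) ≤ load G T r par A q k v c f := by
  have := h.k_pos
  refine Finset.sum_le_sum fun w hw => ?_
  simp only [Finset.mem_filter, Finset.mem_univ, true_and] at hw
  rcases h.weight_update v (k - 1) 0 w (by omega) with h1 | ⟨j, hj, hjb, -⟩
  · exact h1 y
  · have h1 := h.parent.dist_iterate j w (by omega)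
    have h2 := h.parent.dist_iterate (k - 1) w (by omega)
    rw [hjb] at h1
    rw [hw.2] at h2
    refine absurd ?_ (hc (k - 1 - j) (by omega) ?_)
    · omega
    · rw [← hjb, ← Function.iterate_add_apply, ← hw.2]
      congr 1
      omega

/-- Among k consecutive levels at most one is congruent to a, so at most one factor can increase. It
is affine in its load, whose average does not increase, and the other factors are bounded by their
old values. -/
theorem Step.sum_potential_update [Fintype V] [Fintype W] (h : Step G T r par A q k f b x s)
    (hκ : 0 ≤ κ) (v : V) (a : ℕ) :
    ∑ y ∈ s, potential G T r par A q κ k v a (Function.update f b (some y)) ≤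
      s.card * potential G T r par A q κ k v a f := by
  classical
  have hA := h.pos
  have hq := h.nonneg
  by_cases hc : ∃ i < k, T.dist r (par^[i] b) % k = a ∧ T.dist r (par^[i] b) + i = T.dist r b
  · obtain ⟨i, hik, hia, hid⟩ := hc
    have hmem : par^[i] b ∈ Finset.univ.filter fun c => T.dist r c % k = a := by simpa using hia
    have hle : ∀ y, potential G T r par A q κ k v a (Function.update f b (some y)) ≤
        (1 + κ * load G T r par A q k v (par^[i] b) (Function.update f b (some y))) *
        ∏ c ∈ (Finset.univ.filter fun c => T.dist r c % k = a).erase (par^[i] b),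
          (1 + κ * load G T r par A q k v c f) := fun y => by
      rw [potential, ← Finset.mul_prod_erase _ _ hmem]
      refine mul_le_mul_of_nonneg_left ?_
        (zero_le_one.trans (one_le_load_factor hA hq hκ k _))
      refine Finset.prod_le_prod
        (fun c _ => zero_le_one.trans (one_le_load_factor hA hq hκ k _)) fun c hca => ?_
      have hca' : c ≠ par^[i] b ∧ T.dist r c % k = a := by simpa using hca
      gcongr
      refine h.load_update_le v c (fun i' hi' hci hdi => hca'.1 ?_) y
      have hii : i' = i := by
        have h1 : T.dist r c + i' = T.dist r (par^[i] b) + i := by omega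
        have h2 : T.dist r c ≡ T.dist r (par^[i] b) [MOD k] := hca'.2.trans hia.symm
        have h3 : i' ≡ i [MOD k] := Nat.ModEq.add_left_cancel h2 (by rw [h1])
        exact Nat.ModEq.eq_of_lt_of_lt h3 hi' hik
      rw [← hci, hii]
    refine (Finset.sum_le_sum fun y _ => hle y).trans ?_
    rw [← Finset.sum_mul, potential, ← Finset.mul_prod_erase _ _ hmem, ← mul_assoc]
    refine mul_le_mul_of_nonneg_right ?_ (Finset.prod_nonneg
      fun c _ => zero_le_one.trans (one_le_load_factor hA hq hκ k _))
    rw [Finset.sum_add_distrib, ← Finset.mul_sum]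
    have := mul_le_mul_of_nonneg_left (h.sum_load_update v (par^[i] b)) hκ
    simp only [Finset.sum_const, nsmul_eq_mul]
    linarith
  -- No ancestor of b within the window has residue a, so no factor can increase.
  · have hle : ∀ y ∈ s, potential G T r par A q κ k v a (Function.update f b (some y)) ≤
        potential G T r par A q κ k v a f := fun y _ => by
      refine Finset.prod_le_prod
        (fun c _ => zero_le_one.trans (one_le_load_factor hA hq hκ k _)) fun c hca => ?_
      have hca' : T.dist r c % k = a := by simpa using hca
      gcongr
      refine h.load_update_le v c (fun i hi hci hdi => hc ⟨i, hi, ?_, ?_⟩) y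
      · rwa [hci]
      · rwa [hci]
    simpa using Finset.sum_le_sum hle

theorem Step.sum_totalPotential_update [Fintype V] [Fintype W] {coef : ℕ → ℝ}
    (h : Step G T r par A q k f b x s) (hκ : 0 ≤ κ) (hc : ∀ a, 0 ≤ coef a) :
    ∑ y ∈ s, totalPotential G T r par A q κ k coef (Function.update f b (some y)) ≤
      s.card * totalPotential G T r par A q κ k coef f := by
  simp only [totalPotential]
  rw [Finset.sum_comm, Finset.mul_sum]
  refine Finset.sum_le_sum fun v _ => ?_
  rw [Finset.sum_comm, Finset.mul_sum]
  refine Finset.sum_le_sum fun a _ => ?_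
  rw [← Finset.mul_sum, mul_left_comm]
  exact mul_le_mul_of_nonneg_left (h.sum_potential_update hκ v a) (hc a)

end Step

/-! ### A small potential bounds the number of occupied neighbours -/

/-- A partial embedding of a subtree of `T` containing the root. -/
structure Coherent {V W : Type*} (G : SimpleGraph V) (T : SimpleGraph W) (r : W)
    (f : W → Option V) : Prop where
  root : f r ≠ none
  adj : ∀ u w y, IsChild T r u w → f w = some y → ∃ x, f u = some x ∧ G.Adj x y
  inj : ∀ a b x, f a = some x → f b = some x → a = b

section Occupied

variable {V W : Type*} {G : SimpleGraph V} {T : SimpleGraph W} {r : W}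
  {par : W → W} {A q κ : ℝ} {v : V} {f : W → Option V} {k : ℕ}

/-- The image of the tree path from an ancestor down to w; it has no repetition because f is
injective and depths along it differ. -/
theorem Coherent.exists_walk (hf : Coherent G T r f) (hpar : IsParentMap T r par) (j : ℕ) (w : W)
    (hj : j ≤ T.dist r w) {y : V} (hy : f w = some y) :
    ∃ x, f (par^[j] w) = some x ∧ ∃ p : G.Walk x y, p.IsPath ∧ p.length = j ∧
      ∀ z ∈ p.support, ∃ i ≤ j, f (par^[i] w) = some z := by
  induction j generalizing w y with
  | zero => exact ⟨y, hy, .nil, by simp, rfl, fun z hz => ⟨0, le_rfl, by simp_all⟩⟩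
  | succ j ih =>
    have hw : w ≠ r := by
      rintro rfl
      simp at hj
    have hchild := hpar.isChild hw
    have hdist := hchild.2
    obtain ⟨y', hy', hadj⟩ := hf.adj _ _ _ hchild hy
    obtain ⟨x, hx, p, hp, hlen, hsupp⟩ := ih (par w) (by omega) hy'
    refine ⟨x, hx, p.concat hadj, hp.concat (fun hmem => ?_) hadj, ?_, fun z hz => ?_⟩
    · obtain ⟨i, hi, hiy⟩ := hsupp y hmem
      have h1 := hpar.dist_iterate i (par w) (by omega)
      rw [hf.inj _ _ _ hiy hy] at h1
      omega
    · rw [SimpleGraph.Walk.length_concat, hlen]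
    · rw [SimpleGraph.Walk.support_concat] at hz
      rcases List.mem_append.1 hz with hz | hz
      · obtain ⟨i, hi, hiz⟩ := hsupp z hz
        exact ⟨i + 1, by omega, hiz⟩
      · obtain rfl : z = y := by simpa using hz
        exact ⟨0, Nat.zero_le _, hy⟩

open scoped Classical in
/-- The tree vertices that occupy a neighbour of `v`. -/
noncomputable def occupants [Fintype W] (G : SimpleGraph V) (f : W → Option V) (v : V) : Finset W :=
  {w | ∃ y, f w = some y ∧ G.Adj y v}

theorem mem_occupants [Fintype W] {w : W} :
    w ∈ occupants G f v ↔ ∃ y, f w = some y ∧ G.Adj y v := by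
  simp [occupants]

-- Following the image of the tree path from c to w by the edge to v gives a path of length j + 1,
-- and its penultimate vertex determines w.
open scoped Classical in
theorem Coherent.card_occupants_below_le [Fintype V] [Fintype W] (hf : Coherent G T r f)
    (hpar : IsParentMap T r par) (hv : v ∉ closedVertices T r f) {j N : ℕ}
    (hN : ∀ x v, numPaths G (j + 1) x v ≤ N) (c : W) :
    ((occupants G f v).filter fun w => j ≤ T.dist r w ∧ par^[j] w = c).card ≤ N := by
  cases hc : f c with
  | none =>
    rw [Finset.card_eq_zero.2]
    · exact Nat.zero_le _
    · refine Finset.eq_empty_of_forall_notMem fun w hw => ?_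
      simp only [Finset.mem_filter, mem_occupants] at hw
      obtain ⟨⟨y, hy, -⟩, hj, rfl⟩ := hw
      obtain ⟨x, hx, -⟩ := hf.exists_walk hpar j w hj hy
      simp [hc] at hx
  | some x =>
    refine le_trans ?_ (hN x v)
    rw [← Set.ncard_coe_finset]
    have key : ∀ w ∈ (((occupants G f v).filter fun w => j ≤ T.dist r w ∧ par^[j] w = c :
        Finset W) : Set W), ∃ p : G.Walk x v, (p.IsPath ∧ p.length = j + 1) ∧
          some p.penultimate = f w := by
      intro w hw
      simp only [Finset.coe_filter, mem_occupants, Set.mem_ofPred_eq] at hw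
      obtain ⟨⟨y, hy, hyv⟩, hj, rfl⟩ := hw
      obtain ⟨x', hx', p, hp, hlen, hsupp⟩ := hf.exists_walk hpar j w hj hy
      obtain rfl : x = x' := by simpa [hc] using hx'
      refine ⟨p.concat hyv, ⟨hp.concat (fun hmem => ?_) hyv, ?_⟩, ?_⟩
      · obtain ⟨i, hi, hiv⟩ := hsupp v hmem
        -- The path misses v: its last vertex is a neighbour of v, and each earlier one has an
        -- embedded child below it, hence is closed.
        cases i with
        | zero =>
          have : y = v := by simpa [hy] using hiv
          exact hyv.ne this
        | succ i =>
          rw [Function.iterate_succ_apply'] at hiv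
          have hd := hpar.dist_iterate i w (by omega)
          have hne : par^[i] w ≠ r := fun e => by
            rw [e] at hd
            simp at hd
            omega
          obtain ⟨z, hz, -⟩ := hf.exists_walk hpar i w (by omega) hy
          exact hv ⟨_, _, hpar.isChild hne, hiv, by simp [hz]⟩
      · rw [SimpleGraph.Walk.length_concat, hlen]
      · rw [SimpleGraph.Walk.penultimate_concat, hy]
    rcases Set.eq_empty_or_nonempty (((occupants G f v).filter fun w =>
      j ≤ T.dist r w ∧ par^[j] w = c : Finset W) : Set W) with h0 | ⟨w₀, hw₀⟩
    · rw [h0]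
      simp
    have : Nonempty (G.Walk x v) := ⟨(key w₀ hw₀).choose⟩
    choose! p hp using key
    apply Set.ncard_le_ncard_of_injOn p (fun w hw => (hp w hw).1) ?_
      ((finite_walks G (j + 1) x v).subset fun p hp => hp.2)
    intro w hw w' hw' hww
    have h1 := (hp w hw).2
    have h2 := (hp w' hw').2
    rw [hww, h2] at h1
    simp only [Finset.coe_filter, mem_occupants, Set.mem_ofPred_eq] at hw
    obtain ⟨⟨y, hy, -⟩, -⟩ := hw
    exact hf.inj _ _ y hy (h1.trans hy)

open scoped Classical in
/-- The vertices of depth at least `k` whose `(k - 1)`-st ancestor lies on a level congruent to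
`a` modulo `k`. -/
noncomputable def deepClass [Fintype W] (T : SimpleGraph W) (r : W) (par : W → W) (k a : ℕ) :
    Finset W :=
  {w | k ≤ T.dist r w ∧ T.dist r (par^[k - 1] w) % k = a}

/-- From log(1 + y) ≥ 2y/(y + 2) ≥ y(1 - y) with y = κX. The factor 1 - κM is the price of using
products of 1 + κX in place of exponentials. -/
theorem exp_mul_le_one_add {κ M X : ℝ} (hκ : 0 ≤ κ) (hX : 0 ≤ X) (hXM : X ≤ M) :
    Real.exp (κ * (1 - κ * M) * X) ≤ 1 + κ * X := by
  have h0 : 0 ≤ κ * X := mul_nonneg hκ hX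
  rw [← Real.le_log_iff_exp_le (by positivity)]
  refine le_trans ?_ (Real.le_log_one_add_of_nonneg h0)
  have h1 : κ * (1 - κ * M) * X ≤ κ * X * (1 - κ * X) := by
    nlinarith [mul_le_mul_of_nonneg_left hXM hκ]
  refine h1.trans ?_
  rw [le_div_iff₀ (by positivity)]
  nlinarith [mul_nonneg h0 h0, mul_nonneg (mul_nonneg h0 h0) h0]

-- An occupant of a neighbour of v has weight at least 1: the single edge to v is a path that avoids
-- the closed vertices.
open scoped Classical in
theorem Coherent.card_occupants_le_load [Fintype V] [Fintype W]
    (hv : v ∉ closedVertices T r f) (hA : 0 < A) (hq : 0 ≤ q) (c : W) :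
    (((occupants G f v).filter fun w => k ≤ T.dist r w ∧ par^[k - 1] w = c).card : ℝ) ≤
      load G T r par A q k v c f := by
  rw [Finset.card_eq_sum_ones, Nat.cast_sum, Finset.sum_filter, load, Finset.sum_filter]
  refine (Finset.sum_le_sum fun w hw => ?_).trans (Finset.sum_le_sum_of_subset_of_nonneg
    (Finset.subset_univ (occupants G f v)) fun w _ _ => ?_)
  · split_ifs
    · obtain ⟨y, hy, hyv⟩ := mem_occupants.1 hw
      rw [weight_of_some hy]
      simpa using one_le_pathsAvoiding_one hyv hv
    · simp
  · split_ifs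
    · exact weight_nonneg hA hq _ _ _
    · exact le_rfl

-- Each group has between 0 and N occupants, so `exp_mul_le_one_add` applies group by group; loads
-- dominate the actual counts.
open scoped Classical in
theorem Coherent.exp_le_potential [Fintype V] [Fintype W] (hf : Coherent G T r f)
    (hpar : IsParentMap T r par) (hv : v ∉ closedVertices T r f) (hk : 0 < k) {N : ℕ}
    (hN : ∀ x v, numPaths G k x v ≤ N) (hA : 0 < A) (hq : 0 ≤ q) (hκ : 0 ≤ κ) (a : ℕ) :
    Real.exp (κ * (1 - κ * N) * ((occupants G f v) ∩ deepClass T r par k a).card) ≤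
      potential G T r par A q κ k v a f := by
  have hcard : ((occupants G f v) ∩ deepClass T r par k a).card =
      ∑ c with T.dist r c % k = a,
        ((occupants G f v).filter fun w => k ≤ T.dist r w ∧ par^[k - 1] w = c).card := by
    rw [Finset.card_eq_sum_card_fiberwise (f := par^[k - 1])
      (t := Finset.univ.filter fun c => T.dist r c % k = a)]
    · refine Finset.sum_congr rfl fun c hc => congrArg _ ?_
      ext w
      simp only [Finset.mem_filter, Finset.mem_univ, true_and] at hc
      simp only [deepClass, Finset.mem_filter, Finset.mem_inter, Finset.mem_univ, true_and]
      constructor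
      · rintro ⟨⟨h1, h2, -⟩, h3⟩
        exact ⟨h1, h2, h3⟩
      · rintro ⟨h1, h2, rfl⟩
        exact ⟨⟨h1, h2, hc⟩, rfl⟩
    · intro w hw
      simp only [deepClass, Finset.coe_inter, Finset.coe_filter, Set.mem_inter_iff,
        Finset.mem_univ, true_and, Set.mem_ofPred_eq] at hw
      simpa using hw.2.2
  rw [hcard, Nat.cast_sum, Finset.mul_sum, Real.exp_sum, potential]
  refine Finset.prod_le_prod (fun _ _ => (Real.exp_pos _).le) fun c _ => ?_
  refine (exp_mul_le_one_add hκ (Nat.cast_nonneg _) (Nat.cast_le.2 ?_)).trans ?_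
  · refine le_trans (Finset.card_le_card ?_) (hf.card_occupants_below_le hpar hv (j := k - 1)
      (by rwa [Nat.sub_add_cancel hk]) c)
    intro w hw
    simp only [Finset.mem_filter] at hw ⊢
    exact ⟨hw.1, by omega, hw.2.2⟩
  · gcongr
    exact Coherent.card_occupants_le_load hv hA hq c

/-- If the total potential is less than one, then no vertex that is not closed has too many
occupied neighbours. -/
theorem Coherent.card_occupants_le [Fintype V] [Fintype W] (hf : Coherent G T r f)
    (hT : T.IsTree) (hpar : IsParentMap T r par) (hv : v ∉ closedVertices T r f) (hk : 0 < k)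
    {N : ℕ} (hN : ∀ j ≤ k, ∀ x v, numPaths G j x v ≤ N) (hA : 0 < A) (hq : 0 ≤ q) (hκ : 0 ≤ κ)
    (hκN : κ * N ≤ 1) (τ : ℕ → ℝ)
    (hlt : totalPotential G T r par A q κ k (fun a => Real.exp (-(κ * (1 - κ * N) * τ a))) f < 1) :
    ((occupants G f v).card : ℝ) ≤ k * N + ∑ a ∈ Finset.range k, τ a := by
  classical
  -- A sum of nonnegative terms below 1 has each term below 1, and then the exponential lower bound
  -- forces the count under τ a.
  have hdeep : ∀ a ∈ Finset.range k,
      (((occupants G f v) ∩ deepClass T r par k a).card : ℝ) ≤ τ a := fun a ha => by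
    have h1 : Real.exp (-(κ * (1 - κ * N) * τ a)) * potential G T r par A q κ k v a f < 1 := by
      refine lt_of_le_of_lt ?_ hlt
      have hnn : ∀ v a, 0 ≤ Real.exp (-(κ * (1 - κ * N) * τ a)) *
          potential G T r par A q κ k v a f := fun v a =>
        mul_nonneg (Real.exp_pos _).le (potential_nonneg hA hq hκ k a)
      refine (Finset.single_le_sum (f := fun a => Real.exp (-(κ * (1 - κ * N) * τ a)) *
        potential G T r par A q κ k v a f) (fun a _ => hnn v a) ha).trans ?_
      exact Finset.single_le_sum (f := fun v => ∑ a ∈ Finset.range k,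
        Real.exp (-(κ * (1 - κ * N) * τ a)) * potential G T r par A q κ k v a f)
        (fun v _ => Finset.sum_nonneg fun a _ => hnn v a) (Finset.mem_univ v)
    have h2 := hf.exp_le_potential hpar hv hk (hN k le_rfl) hA hq hκ a
    have h3 := (mul_le_mul_of_nonneg_left h2
      (Real.exp_pos (-(κ * (1 - κ * N) * τ a))).le).trans_lt h1
    rw [← Real.exp_add, Real.exp_lt_one_iff] at h3
    have h4 : 0 ≤ κ * (1 - κ * N) := mul_nonneg hκ (by linarith)
    exact (lt_of_mul_lt_mul_left (by linarith) h4).le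
  -- On level j the j-th ancestor is always r, so the deterministic path count applies with c = r.
  have hshallow : ∀ j ∈ Finset.range k,
      ((occupants G f v).filter fun w => T.dist r w = j).card ≤ N := fun j hj => by
    refine le_trans (Finset.card_le_card ?_) (hf.card_occupants_below_le hpar hv (j := j)
      (hN (j + 1) (Finset.mem_range.1 hj)) r)
    intro w hw
    simp only [Finset.mem_filter] at hw ⊢
    obtain ⟨h1, rfl⟩ := hw
    exact ⟨h1, le_rfl, hpar.iterate_dist hT w⟩
  have hcover : occupants G f v ⊆
      ((Finset.range k).biUnion fun j => (occupants G f v).filter fun w => T.dist r w = j) ∪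
      ((Finset.range k).biUnion fun a => (occupants G f v) ∩ deepClass T r par k a) := by
    intro w hw
    simp only [Finset.mem_union, Finset.mem_biUnion, Finset.mem_range, Finset.mem_filter,
      Finset.mem_inter, deepClass, Finset.mem_univ, true_and]
    rcases lt_or_ge (T.dist r w) k with h | h
    · exact Or.inl ⟨_, h, hw, rfl⟩
    · exact Or.inr ⟨_, Nat.mod_lt _ hk, hw, h, rfl⟩
  have h1 := (Finset.card_le_card hcover).trans (Finset.card_union_le _ _)
  have h2 : ((Finset.range k).biUnion fun j =>
      (occupants G f v).filter fun w => T.dist r w = j).card ≤ k * N := by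
    simpa using Finset.card_biUnion_le_card_mul _ _ N hshallow
  have h3 : (((Finset.range k).biUnion fun a =>
      (occupants G f v) ∩ deepClass T r par k a).card : ℝ) ≤ ∑ a ∈ Finset.range k, τ a := by
    refine (Nat.cast_le.2 Finset.card_biUnion_le).trans ?_
    rw [Nat.cast_sum]
    exact Finset.sum_le_sum hdeep
  have h4 : ((occupants G f v).card : ℝ) ≤ ((k * N : ℕ) : ℝ) + ∑ a ∈ Finset.range k, τ a := by
    refine (Nat.cast_le.2 h1).trans ?_
    rw [Nat.cast_add]
    exact add_le_add (Nat.cast_le.2 h2) h3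
  exact_mod_cast h4

end Occupied

/-! ### The initial potential -/

section Initial

variable {V W : Type*} {G : SimpleGraph V} {T : SimpleGraph W} {r : W}
  {par : W → W} {A q κ : ℝ} {v : V} {f : W → Option V} {k : ℕ}

/-- As i is less than the depth of w, the climb stops below the root, the only vertex that may be
embedded. -/
theorem weight_initial (hpar : IsParentMap T r par) (hf : ∀ w ≠ r, f w = none) (i m : ℕ) (w : W)
    (hi : i < T.dist r w) : weight G T r par A q v f i m w = q := by
  have hw : w ≠ r := by
    rintro rfl
    simp at hi
  induction i generalizing m w with
  | zero => exact weight_zero_of_none (hf w hw) m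
  | succ i ih =>
    have hd := (hpar.isChild hw).2
    rw [weight_succ_of_none (hf w hw)]
    refine ih _ _ (by omega) ?_
    intro e
    rw [e, SimpleGraph.dist_self] at hd
    omega

theorem potential_initial_le [Fintype W] (hpar : IsParentMap T r par) (hf : ∀ w ≠ r, f w = none)
    (hk : 0 < k) (hq : 0 ≤ q) (hκ : 0 ≤ κ) (a : ℕ) :
    potential G T r par A q κ k v a f ≤ Real.exp (κ * (q * (deepClass T r par k a).card)) := by
  classical
  have hload : ∀ c, load G T r par A q k v c f =
      q * (Finset.univ.filter fun w => k ≤ T.dist r w ∧ par^[k - 1] w = c).card := fun c => by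
    rw [load, Finset.sum_congr rfl fun w hw => weight_initial hpar hf (k - 1) 0 w ?_]
    · rw [Finset.sum_const, nsmul_eq_mul, mul_comm]
    · have := (Finset.mem_filter.1 hw).2.1
      omega
  have hcard : (deepClass T r par k a).card = ∑ c with T.dist r c % k = a,
      (Finset.univ.filter fun w => k ≤ T.dist r w ∧ par^[k - 1] w = c).card := by
    rw [Finset.card_eq_sum_card_fiberwise (f := par^[k - 1])
      (t := Finset.univ.filter fun c => T.dist r c % k = a)]
    · refine Finset.sum_congr rfl fun c hc => congrArg _ ?_
      ext w
      simp only [Finset.mem_filter, Finset.mem_univ, true_and] at hc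
      simp only [deepClass, Finset.mem_filter, Finset.mem_univ, true_and]
      constructor
      · rintro ⟨⟨h2, -⟩, h3⟩
        exact ⟨h2, h3⟩
      · rintro ⟨h2, rfl⟩
        exact ⟨⟨h2, hc⟩, rfl⟩
    · intro w hw
      simp only [deepClass, Finset.coe_filter, Finset.mem_univ, true_and,
        Set.mem_ofPred_eq] at hw
      simpa using hw.2
  rw [hcard, Nat.cast_sum, Finset.mul_sum, Finset.mul_sum, Real.exp_sum, potential]
  refine Finset.prod_le_prod (fun c _ => ?_) fun c _ => ?_
  · rw [hload]
    positivity
  · rw [hload, add_comm]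
    exact Real.add_one_le_exp _

theorem sum_card_deepClass_le [Fintype W] (T : SimpleGraph W) (r : W) (par : W → W) (k : ℕ) :
    ∑ a ∈ Finset.range k, (deepClass T r par k a).card ≤ Fintype.card W := by
  classical
  rw [← Finset.card_biUnion]
  · exact Finset.card_le_univ _
  · intro a _ b _ hab
    refine Finset.disjoint_left.2 fun w ha hb => hab ?_
    simp only [deepClass, Finset.mem_filter] at ha hb
    rw [← ha.2.2, hb.2.2]

end Initial

/-! ### Failure probabilities -/

section Probability

theorem toOuterMeasure_le_one {α : Type*} (p : PMF α) (E : Set α) : p.toOuterMeasure E ≤ 1 := by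
  rw [PMF.toOuterMeasure_apply, ← p.tsum_coe]
  exact ENNReal.tsum_le_tsum fun a => Set.indicator_le_self _ _ _

theorem toOuterMeasure_add_compl {α : Type*} (p : PMF α) (E : Set α) :
    p.toOuterMeasure E + p.toOuterMeasure Eᶜ = 1 := by
  rw [PMF.toOuterMeasure_apply, PMF.toOuterMeasure_apply, ← ENNReal.tsum_add, ← p.tsum_coe]
  exact tsum_congr fun a => Set.indicator_self_add_compl_apply E p a

theorem andThen_pure_some {α β : Type*} (a : α) (g : α → PMF (Option β)) :
    andThen (PMF.pure (some a)) g = g a := by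
  simp [andThen, PMF.pure_bind]

theorem andThen_assoc {α β γ : Type*} (p : PMF (Option α)) (g : α → PMF (Option β))
    (h : β → PMF (Option γ)) :
    andThen (andThen p g) h = andThen p fun a => andThen (g a) h := by
  simp only [andThen, PMF.bind_bind]
  congr 1
  funext o
  cases o with
  | none => simp [PMF.pure_bind]
  | some a => rfl

/-- Converts an averaging inequality for the potential into a bound on the probability of the bad
event E after one random choice. -/
theorem andThen_pick_le {V β : Type*} [Fintype V] {s : Finset V} (hs : s.Nonempty)
    {g : V → PMF (Option β)} {E : Set (Option β)} {z : V → ℝ} {Z : ℝ} (hz : ∀ y ∈ s, 0 ≤ z y)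
    (hg : ∀ y ∈ s, (g y).toOuterMeasure E ≤ ENNReal.ofReal (z y))
    (hsum : ∑ y ∈ s, z y ≤ s.card * Z) :
    (andThen (pick s) g).toOuterMeasure E ≤ ENNReal.ofReal Z := by
  classical
  have hcard : (0 : ℝ) < s.card := by exact_mod_cast hs.card_pos
  rw [andThen, pick, dif_pos hs, PMF.bind_map, PMF.toOuterMeasure_bind_apply, tsum_fintype]
  simp only [PMF.uniformOfFinset_apply, Function.comp_apply, ite_mul, zero_mul]
  rw [← Finset.sum_filter, Finset.filter_mem_eq_inter, Finset.univ_inter, ← Finset.mul_sum]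
  calc (s.card : ENNReal)⁻¹ * ∑ y ∈ s, (g y).toOuterMeasure E
      ≤ (s.card : ENNReal)⁻¹ * ENNReal.ofReal (s.card * Z) := by
        gcongr
        refine (Finset.sum_le_sum hg).trans ?_
        rw [← ENNReal.ofReal_sum_of_nonneg hz]
        exact ENNReal.ofReal_le_ofReal hsum
    _ = ENNReal.ofReal Z := by
        rw [ENNReal.ofReal_mul hcard.le, ENNReal.ofReal_natCast, ← mul_assoc,
          ENNReal.inv_mul_cancel, one_mul]
        · exact_mod_cast hs.card_pos.ne'
        · exact ENNReal.natCast_ne_top _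

theorem andThen_randomMoves_le {V β : Type*} [Fintype V] {G : SimpleGraph V}
    (hG : ∀ v, (G.neighborSet v).Nonempty) {E : Set (Option β)} {B : ℝ} (hB : 0 ≤ B)
    {g : List V × V → PMF (Option β)} (hg : ∀ x, (g x).toOuterMeasure E ≤ ENNReal.ofReal B)
    (k : ℕ) (past : List V) (v : V) :
    (andThen (randomMoves G k past v) g).toOuterMeasure E ≤ ENNReal.ofReal B := by
  classical
  induction k generalizing past v with
  | zero =>
    rw [randomMoves, andThen_pure_some]
    exact hg _
  | succ k ih =>
    rw [randomMoves, andThen_assoc]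
    obtain ⟨y, hy⟩ := hG v
    refine andThen_pick_le (z := fun _ => B) ⟨y, ?_⟩ (fun _ _ => hB) (fun y _ => ih _ _) ?_
    · rw [SimpleGraph.mem_neighborFinset]
      exact hy
    · rw [Finset.sum_const, nsmul_eq_mul]

end Probability

/-! ### The algorithm -/

section Algorithm

variable {V W : Type*} [Fintype V] [Fintype W] {G : SimpleGraph V} {T : SimpleGraph W} {r : W}

theorem card_neighborSet_le (f : W → Option V) (x : V) :
    (G.neighborSet x).ncard ≤ (available G f x).card + (occupants G f x).card := by
  classical
  have h : G.neighborSet x ⊆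
      -- The default x is never used, since occupants are embedded.
      ((available G f x ∪ (occupants G f x).image fun w => (f w).getD x : Finset V) : Set V) := by
    intro y hy
    simp only [Finset.coe_union, Set.mem_union, Finset.mem_coe, available, Finset.mem_filter,
      Finset.mem_univ, true_and, Finset.mem_image, mem_occupants]
    by_cases hw : ∀ w, f w ≠ some y
    · exact Or.inl ⟨hy, hw⟩
    · push Not at hw
      obtain ⟨w, hw⟩ := hw
      exact Or.inr ⟨w, ⟨y, hw, SimpleGraph.Adj.symm hy⟩, by simp [hw]⟩
  refine (Set.ncard_le_ncard h (Finset.finite_toSet _)).trans ?_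
  rw [Set.ncard_coe_finset]
  exact (Finset.card_union_le _ _).trans (Nat.add_le_add_left Finset.card_image_le _)

/-- If one child of a vertex is embedded, then all of them are. -/
def SiblingClosed (T : SimpleGraph W) (r : W) (f : W → Option V) : Prop :=
  ∀ u w w', IsChild T r u w → IsChild T r u w' → f w ≠ none → f w' ≠ none

omit [Fintype V] [Fintype W] in
-- Climb from an unembedded vertex until the parent is embedded; by sibling-closedness no child of
-- that parent is embedded.
theorem exists_ready {par : W → W} (hpar : IsParentMap T r par) {f : W → Option V}
    (hf : f r ≠ none) (hsib : SiblingClosed T r f) (h : ¬ ∀ w, f w ≠ none) :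
    ∃ u, Ready T r f u := by
  have key : ∀ n w, T.dist r w = n → f w = none → ∃ u, Ready T r f u := by
    intro n
    induction n with
    | zero =>
      intro w hw hfw
      by_cases hwr : w = r
      · exact absurd (hwr ▸ hfw) hf
      · have := (hpar.isChild hwr).2
        omega
    | succ n ih =>
      intro w hw hfw
      by_cases hwr : w = r
      · exact absurd (hwr ▸ hfw) hf
      · have hchild := hpar.isChild hwr
        by_cases hu : f (par w) = none
        · exact ih _ (by have := hchild.2; omega) hu
        · refine ⟨par w, hu, ⟨w, hchild⟩, fun w' hw' => ?_⟩
          by_contra h'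
          exact hsib _ _ _ hw' hchild h' hfw
  push Not at h
  obtain ⟨w, hw⟩ := h
  exact key _ w rfl hw

omit [Fintype V] [Fintype W] in
theorem Coherent.isEmbedding {f : W → Option V} (hf : Coherent G T r f) (hT : T.IsTree)
    (h : ∀ w, f w ≠ none) : IsEmbedding T G (some f) := by
  choose φ hφ using fun w => Option.ne_none_iff_exists'.1 (h w)
  have hadj : ∀ a b, IsChild T r a b → G.Adj (φ a) (φ b) := fun a b hab => by
    obtain ⟨x, hx, hxy⟩ := hf.adj a b _ hab (hφ b)
    rw [hφ a, Option.some.injEq] at hx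
    rwa [hx]
  refine ⟨φ, congrArg some (funext hφ), fun a b hab => ?_, fun a b hab => ?_⟩
  · exact hf.inj a b (φ a) (hφ a) (by rw [hφ b, hab])
  · rcases hT.dist_eq_dist_add_one_of_adj r hab with h1 | h1
    · exact (hadj b a ⟨hab.symm, h1⟩).symm
    · exact hadj a b ⟨hab, h1⟩

omit [Fintype V] [Fintype W] in
theorem Coherent.update [DecidableEq W] {f : W → Option V} (hf : Coherent G T r f)
    {par : W → W} (hpar : IsParentMap T r par) {b : W} {x y : V} (hb : f b = none)
    (hx : f (par b) = some x) (hbr : b ≠ r) (hxy : G.Adj x y) (hy : ∀ w, f w ≠ some y) :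
    Coherent G T r (Function.update f b (some y)) where
  root := by rw [Function.update_of_ne hbr.symm]; exact hf.root
  adj u w z huw hz := by
    by_cases hwb : w = b
    · subst hwb
      obtain rfl : par w = u := ((hpar _ _).1 huw).2
      obtain rfl : y = z := by simpa using hz
      have : par w ≠ w := fun e => by rw [e, hb] at hx; simp at hx
      exact ⟨x, by rw [Function.update_of_ne this, hx], hxy⟩
    · rw [Function.update_of_ne hwb] at hz
      obtain ⟨x', hx', hadj⟩ := hf.adj u w z huw hz
      have : u ≠ b := fun e => by rw [e, hb] at hx'; simp at hx'
      exact ⟨x', by rw [Function.update_of_ne this, hx'], hadj⟩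
  inj a c z ha hc := by
    by_cases hab : a = b <;> by_cases hcb : c = b
    · rw [hab, hcb]
    · subst hab
      rw [Function.update_self, Option.some.injEq] at ha
      rw [Function.update_of_ne hcb] at hc
      exact absurd (ha ▸ hc) (hy c)
    · subst hcb
      rw [Function.update_self, Option.some.injEq] at hc
      rw [Function.update_of_ne hab] at ha
      exact absurd (hc ▸ ha) (hy a)
    · rw [Function.update_of_ne hab] at ha
      rw [Function.update_of_ne hcb] at hc
      exact hf.inj a c z ha hc

omit [Fintype W] in
theorem card_available_le_update [DecidableEq W] (f : W → Option V) (b : W) (x y : V)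
    (hb : f b = none) :
    (available G f x).card ≤ (available G (Function.update f b (some y)) x).card + 1 := by
  classical
  rw [← Finset.card_singleton y]
  refine (Finset.card_le_card fun z hz => ?_).trans (Finset.card_union_le _ _)
  simp only [available, Finset.mem_filter, Finset.mem_univ, true_and, Finset.mem_union,
    Finset.mem_singleton] at hz ⊢
  by_cases hzy : z = y
  · exact Or.inr hzy
  · refine Or.inl ⟨hz.1, fun w => ?_⟩
    by_cases hw : w = b
    · subst hw
      simpa using Ne.symm hzy
    · rw [Function.update_of_ne hw]
      exact hz.2 w

/-- Parameters for which the total potential controls the failure probability. -/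
structure Controlled (G : SimpleGraph V) (T : SimpleGraph W) (r : W) (par : W → W) (A q κ : ℝ)
    (k N : ℕ) (τ : ℕ → ℝ) : Prop where
  tree : T.IsTree
  parent : IsParentMap T r par
  k_pos : 0 < k
  pos : 0 < A
  q_nonneg : 0 ≤ q
  κ_nonneg : 0 ≤ κ
  κ_mul_le : κ * N ≤ 1
  paths_le : ∀ j ≤ k, ∀ x v, numPaths G j x v ≤ N
  paths_succ_le : ∀ x v, (numPaths G (k + 1) x v : ℝ) ≤ q * A ^ k
  room : ∀ (x : V) (u : W) (l : List W), l.Nodup → (∀ w ∈ l, IsChild T r u w) →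
    l.length + A + (k * N + ∑ a ∈ Finset.range k, τ a) ≤ (G.neighborSet x).ncard

/-- The total potential in which the bad events are exceedings of the thresholds `τ`. -/
noncomputable def failureBound (G : SimpleGraph V) (T : SimpleGraph W) (r : W) (par : W → W)
    (A q κ : ℝ) (k N : ℕ) (τ : ℕ → ℝ) (f : W → Option V) : ℝ :=
  totalPotential G T r par A q κ k (fun a => Real.exp (-(κ * (1 - κ * N) * τ a))) f

variable {par : W → W} {A q κ : ℝ} {k N : ℕ} {τ : ℕ → ℝ}

theorem Controlled.failureBound_nonneg (h : Controlled G T r par A q κ k N τ) (f : W → Option V) :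
    0 ≤ failureBound G T r par A q κ k N τ f :=
  totalPotential_nonneg h.pos h.q_nonneg h.κ_nonneg k fun _ => (Real.exp_pos _).le

/-- Stated with an arbitrary continuation g so that the induction over the children can be nested in
the one over the rounds. Inside a round sibling-closedness may fail at u only, and each child uses
up at most one available vertex, so at least A remain for every choice. -/
theorem Controlled.embedList_le (h : Controlled G T r par A q κ k N τ) {u : W} {x : V}
    {E : Set (Option (W → Option V))} {g : (W → Option V) → PMF (Option (W → Option V))}
    (l : List W) (f : W → Option V) (hf : Coherent G T r f) (hu : f u = some x) (hl : l.Nodup)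
    (hchild : ∀ w ∈ l, IsChild T r u w) (hnone : ∀ w ∈ l, f w = none)
    (hsib : ∀ u' w w', u' ≠ u → IsChild T r u' w → IsChild T r u' w' → f w ≠ none → f w' ≠ none)
    (hall : ∀ w, IsChild T r u w → f w ≠ none ∨ w ∈ l)
    (hav : A + l.length ≤ (available G f x).card)
    (hg : ∀ f', Coherent G T r f' → SiblingClosed T r f' → (∀ w, f w ≠ none → f' w ≠ none) →
      (∀ w ∈ l, f' w ≠ none) →
      (g f').toOuterMeasure E ≤ ENNReal.ofReal (failureBound G T r par A q κ k N τ f')) :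
    (andThen (embedList G x l f) g).toOuterMeasure E ≤
      ENNReal.ofReal (failureBound G T r par A q κ k N τ f) := by
  classical
  induction l generalizing f with
  | nil =>
    rw [embedList, andThen_pure_some]
    refine hg f hf (fun u' w w' hw hw' hfw => ?_) (fun _ => id) (by simp)
    by_cases hu' : u' = u
    · subst hu'
      simpa using hall w' hw'
    · exact hsib u' w w' hu' hw hw' hfw
  | cons b l ih =>
    have hb : f b = none := hnone b (by simp)
    have hbchild := hchild b (by simp)
    obtain ⟨hbr, hbu⟩ := (h.parent u b).1 hbchild
    have hav' : A + (l.length + 1) ≤ (available G f x).card := by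
      simpa using hav
    have hstep : Step G T r par A q k f b x (available G f x) :=
      { parent := h.parent
        ne_root := hbr
        pos := h.pos
        nonneg := h.q_nonneg
        k_pos := h.k_pos
        paths_le := h.paths_succ_le
        unembedded := hb
        embedded := by rw [hbu, hu]
        adj := fun y hy => by
          simp only [available, Finset.mem_filter] at hy
          exact hy.2.1
        unoccupied := fun y hy => by
          simp only [available, Finset.mem_filter] at hy
          exact hy.2.2
        le_card := by
          have : (0 : ℝ) ≤ l.length := Nat.cast_nonneg _
          linarith }
    have hne : (available G f x).Nonempty := by
      rw [← Finset.card_pos]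
      exact_mod_cast h.pos.trans_le hstep.le_card
    have hub : u ≠ b := fun e => by rw [e, hb] at hu; simp at hu
    rw [embedList, andThen_assoc]
    refine andThen_pick_le hne (z := fun y => failureBound G T r par A q κ k N τ
      (Function.update f b (some y))) (fun y _ => h.failureBound_nonneg _) (fun y hy => ?_)
      (hstep.sum_totalPotential_update h.κ_nonneg fun _ => (Real.exp_pos _).le)
    have hmono : ∀ w, f w ≠ none → Function.update f b (some y) w ≠ none := fun w hw => by
      by_cases hwb : w = b
      · subst hwb
        simp
      · rwa [Function.update_of_ne hwb]
    have hlb : ∀ w ∈ l, w ≠ b := fun w hw e => (List.nodup_cons.1 hl).1 (e ▸ hw)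
    convert ih (Function.update f b (some y)) (hf.update h.parent hb (by rw [hbu, hu]) hbr
      (hstep.adj y hy) (hstep.unoccupied y hy)) (by rwa [Function.update_of_ne hub])
      (List.nodup_cons.1 hl).2 (fun w hw => hchild w (by simp [hw]))
      (fun w hw => by rw [Function.update_of_ne (hlb w hw)]; exact hnone w (by simp [hw]))
      ?_ ?_ ?_ ?_ using 6
    · intro u' w w' hu' hw hw' hfw
      have hwb : w ≠ b := by
        rintro rfl
        exact hu' (((h.parent _ _).1 hw).2.symm.trans hbu)
      rw [Function.update_of_ne hwb] at hfw
      exact hmono _ (hsib u' w w' hu' hw hw' hfw)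
    · intro w hw
      rcases hall w hw with h1 | h1
      · exact Or.inl (hmono w h1)
      · rcases List.mem_cons.1 h1 with rfl | h1
        · exact Or.inl (by simp)
        · exact Or.inr h1
    · have := card_available_le_update (G := G) f b x y hb
      have h1 : ((available G f x).card : ℝ) ≤
          (available G (Function.update f b (some y)) x).card + 1 := by exact_mod_cast this
      linarith
    · intro f' hf' hs' hm' hl'
      refine hg f' hf' hs' (fun w hw => hm' w (hmono w hw)) fun w hw => ?_
      rcases List.mem_cons.1 hw with rfl | hw
      · exact hm' _ (by simp)
      · exact hl' w hw

open scoped Classical in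
theorem Controlled.rounds_le (h : Controlled G T r par A q κ k N τ) (σ : Schedule T r V)
    (past : List V) (m : ℕ) (f : W → Option V) (hf : Coherent G T r f)
    (hsib : SiblingClosed T r f) (hm : (Finset.univ.filter fun w => f w = none).card ≤ m) :
    (rounds G σ past m f).toOuterMeasure {o | IsEmbedding T G o}ᶜ ≤
      ENNReal.ofReal (failureBound G T r par A q κ k N τ f) := by
  have hdone : ∀ f : W → Option V, Coherent G T r f → (∀ w, f w ≠ none) →
      (PMF.pure (some f)).toOuterMeasure {o | IsEmbedding T G o}ᶜ ≤
        ENNReal.ofReal (failureBound G T r par A q κ k N τ f) := fun f hf hall => by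
    rw [PMF.toOuterMeasure_pure_apply, if_neg]
    · exact zero_le
    · simpa using hf.isEmbedding h.tree hall
  induction m generalizing f with
  | zero =>
    rw [rounds]
    refine hdone f hf fun w hw => ?_
    have := Finset.card_eq_zero.1 (Nat.le_zero.1 hm)
    simpa using Finset.eq_empty_iff_forall_notMem.1 this w (by simpa using hw)
  | succ m ih =>
    rw [rounds]
    split_ifs with hall
    · exact hdone f hf hall
    · obtain ⟨hu, ⟨w₀, hw₀⟩, hnone⟩ := σ.next_ready past f
        (exists_ready h.parent hf.root hsib hall)
      obtain ⟨x, hx⟩ := Option.ne_none_iff_exists'.1 hu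
      -- From here on the potential may be taken below 1, so this round cannot fail.
      rcases le_or_gt 1 (failureBound G T r par A q κ k N τ f) with hZ | hZ
      · refine (toOuterMeasure_le_one _ _).trans ?_
        rw [← ENNReal.ofReal_one]
        exact ENNReal.ofReal_le_ofReal hZ
      have hclosed : x ∉ closedVertices T r f := by
        rintro ⟨u', w, huw, hu', hw⟩
        rw [hf.inj _ _ _ hu' hx] at huw
        exact hw (hnone w huw)
      have hocc := hf.card_occupants_le h.tree h.parent hclosed h.k_pos h.paths_le h.pos
        h.q_nonneg h.κ_nonneg h.κ_mul_le τ hZ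
      have hroom := h.room x (σ.next past f) (σ.order past f) (σ.order_nodup past f)
        fun w hw => (σ.mem_order past f w).1 hw
      have hav : A + (σ.order past f).length ≤ (available G f x).card := by
        have h1 : ((G.neighborSet x).ncard : ℝ) ≤
            (available G f x).card + (occupants G f x).card := by
          exact_mod_cast card_neighborSet_le f x
        linarith
      have hle : (σ.order past f).length ≤ (available G f x).card := by
        have := h.pos
        have h1 : ((σ.order past f).length : ℝ) ≤ (available G f x).card := by linarith
        exact_mod_cast h1
      have hproc : processNext G σ past f = embedList G x (σ.order past f) f := by
        rw [processNext, hx]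
        exact if_pos hle
      rw [hproc]
      refine h.embedList_le (σ.order past f) f hf hx (σ.order_nodup past f)
        (fun w hw => (σ.mem_order past f w).1 hw)
        (fun w hw => hnone w ((σ.mem_order past f w).1 hw))
        (fun u' w w' _ => hsib u' w w') (fun w hw => Or.inr ((σ.mem_order past f w).2 hw)) hav
        fun f' hf' hs' hmono hl' => ih f' hf' hs' ?_
      -- The round embeds at least the child `w₀`, so the number of unembedded vertices drops.
      refine Nat.le_of_lt_succ (lt_of_lt_of_le (Finset.card_lt_card ?_) hm)
      rw [Finset.ssubset_iff_of_subset]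
      · exact ⟨w₀, by simpa using hnone w₀ hw₀,
          by simpa using hl' w₀ ((σ.mem_order past f w₀).2 hw₀)⟩
      · intro w hw
        simp only [Finset.mem_filter, Finset.mem_univ, true_and] at hw ⊢
        by_contra hfw
        exact hmono w hfw hw

/-- The failure probability is at most `η` if the initial value of the total potential is. -/
theorem Controlled.le_successProb (h : Controlled G T r par A q κ k N τ) (σ : Schedule T r V)
    (v₀ : V) {η : ℝ} (hη : 0 ≤ η)
    (hG : ∀ v, (G.neighborSet v).Nonempty)
    (hinit : ∀ f : W → Option V, (∀ w ≠ r, f w = none) →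
      failureBound G T r par A q κ k N τ f ≤ η) (l : ℕ) :
    ENNReal.ofReal (1 - η) ≤ successProb G σ l v₀ := by
  classical
  have hfail : (randomEmbedding G σ l v₀).toOuterMeasure {o | IsEmbedding T G o}ᶜ ≤
      ENNReal.ofReal η := by
    -- The bound on the potential holds wherever the root is placed, so neither the number nor the
    -- outcome of the initial moves matters.
    refine andThen_randomMoves_le hG hη (fun p => ?_) l [] v₀
    have hf : ∀ w ≠ r, (if w = r then some p.2 else none : Option V) = none :=
      fun w hw => if_neg hw
    have hsome : ∀ w z, (if w = r then some p.2 else none : Option V) = some z → w = r :=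
      fun w z hw => by
        by_contra hne
        rw [if_neg hne] at hw
        simp at hw
    have hnotchild : ∀ u, ¬ IsChild T r u r := fun u hu => ((h.parent _ _).1 hu).1 rfl
    refine (h.rounds_le σ p.1 _ (fun w => if w = r then some p.2 else none)
      ⟨by simp, fun u w y huw hw => ?_, fun a b z ha hb => ?_⟩ (fun u w w' huw _ hw => ?_)
      (Finset.card_le_univ _)).trans (ENNReal.ofReal_le_ofReal (hinit _ hf))
    · rw [hsome w y hw] at huw
      exact absurd huw (hnotchild u)
    · rw [hsome a z ha, hsome b z hb]
    · obtain ⟨z, hz⟩ := Option.ne_none_iff_exists'.1 hw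
      rw [hsome w z hz] at huw
      exact absurd huw (hnotchild u)
  rw [ENNReal.ofReal_sub _ hη, ENNReal.ofReal_one, tsub_le_iff_right,
    ← toOuterMeasure_add_compl (randomEmbedding G σ l v₀) {o | IsEmbedding T G o}]
  exact add_le_add le_rfl hfail

end Algorithm

/-! ### Choice of the parameters -/

/-- The exponential moment estimate behind the union bound. -/
theorem exponent_bound {D k N s κ : ℝ} (hD : 16 ≤ D) (hk : 1 ≤ k) (hkD : k ≤ D) (hN : 0 ≤ N)
    (hND : N ≤ D ^ 2) (hs : s = D ^ 8 / (2 * k ^ 2) - N) (hκ : κ = s * k / (2 * D ^ 10)) :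
    0 ≤ κ ∧ κ * N ≤ 1 ∧ ∀ μ, 0 ≤ μ → μ ≤ D ^ 8 / (2 * k) →
      -(κ * (1 - κ * N) * (μ + s)) + κ * μ ≤ -(D ^ 3 / 64) := by
  have hD0 : 0 < D := by linarith
  have hk0 : 0 < k := by linarith
  have hlo : D ^ 8 / (4 * k ^ 2) ≤ s := by
    have h1 : N ≤ D ^ 8 / (4 * k ^ 2) := by
      rw [le_div_iff₀ (by positivity)]
      have h2 : k ^ 2 ≤ D ^ 2 := by gcongr
      have h3 : (4 : ℝ) ≤ D ^ 4 := by nlinarith [sq_nonneg (D ^ 2 - 4), sq_nonneg D]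
      calc N * (4 * k ^ 2) ≤ D ^ 2 * (4 * D ^ 2) := by gcongr
        _ = 4 * D ^ 4 := by ring
        _ ≤ D ^ 4 * D ^ 4 := by gcongr
        _ = D ^ 8 := by ring
    have h2 : D ^ 8 / (2 * k ^ 2) = D ^ 8 / (4 * k ^ 2) + D ^ 8 / (4 * k ^ 2) := by
      field_simp
      ring
    linarith
  have hs0 : 0 < s := lt_of_lt_of_le (by positivity) hlo
  have hhi : s ≤ D ^ 8 / (2 * k) := by
    have h1 : D ^ 8 / (2 * k ^ 2) ≤ D ^ 8 / (2 * k) := by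
      gcongr
      nlinarith
    linarith
  have hκ0 : 0 ≤ κ := by rw [hκ]; positivity
  -- κ minimizes κ²·D^10/k - κs, which bounds the exponent as N ≤ D^2 and μ + s ≤ D^8/k. The minimum
  -- is -s²k/(4D^10), and s ≥ D^8/(4k²) with k ≤ D brings it below -D^3/64.
  have hκs : κ * (D ^ 2 * (D ^ 8 / k)) = s / 2 := by
    rw [hκ]
    field_simp
  refine ⟨hκ0, ?_, fun μ hμ hμ' => ?_⟩
  · have h1 : κ * D ^ 2 = s * k / (2 * D ^ 8) := by
      rw [hκ]
      field_simp
    refine (mul_le_mul_of_nonneg_left hND hκ0).trans ?_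
    rw [h1, div_le_one (by positivity)]
    rw [le_div_iff₀ (by positivity)] at hhi
    nlinarith [pow_pos hD0 8]
  · have h1 : μ + s ≤ D ^ 8 / k := by
      have : D ^ 8 / k = D ^ 8 / (2 * k) + D ^ 8 / (2 * k) := by
        field_simp
        ring
      linarith
    have h2 : κ * N * (μ + s) ≤ s / 2 := by
      rw [← hκs, mul_assoc]
      gcongr
    have h3 : κ * (κ * N * (μ + s)) ≤ κ * (s / 2) := by gcongr
    have h4 : D ^ 3 / 64 ≤ κ * (s / 2) := by
      have h5 : κ * (s / 2) = s ^ 2 * (k / (4 * D ^ 10)) := by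
        rw [hκ]
        field_simp
        ring
      rw [h5]
      calc D ^ 3 / 64 = D ^ 6 / (64 * D ^ 3) := by field_simp
        _ ≤ D ^ 6 / (64 * k ^ 3) := by gcongr
        _ = (D ^ 8 / (4 * k ^ 2)) ^ 2 * (k / (4 * D ^ 10)) := by
          field_simp
          ring
        _ ≤ s ^ 2 * (k / (4 * D ^ 10)) := by gcongr
    have h6 : -(κ * (1 - κ * N) * (μ + s)) + κ * μ = κ * (κ * N * (μ + s)) - κ * s := by ring
    rw [h6]
    linarith

/-- A union bound over the vertices of G and the k residues. -/
theorem Controlled.failureBound_le {V W : Type*} [Fintype V] [Fintype W] {G : SimpleGraph V}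
    {T : SimpleGraph W} {r : W} {par : W → W} {A q κ : ℝ} {k N : ℕ} {τ : ℕ → ℝ}
    (h : Controlled G T r par A q κ k N τ) {B : ℝ}
    (hB : ∀ a, -(κ * (1 - κ * N) * τ a) + κ * (q * (deepClass T r par k a).card) ≤ B)
    {f : W → Option V} (hf : ∀ w ≠ r, f w = none) :
    failureBound G T r par A q κ k N τ f ≤ Fintype.card V * (k * Real.exp B) := by
  rw [failureBound, totalPotential]
  have h1 : ∀ v a, Real.exp (-(κ * (1 - κ * N) * τ a)) * potential G T r par A q κ k v a f ≤
      Real.exp B := fun v a => by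
    refine (mul_le_mul_of_nonneg_left (potential_initial_le h.parent hf h.k_pos h.q_nonneg
      h.κ_nonneg a) (Real.exp_pos _).le).trans ?_
    rw [← Real.exp_add]
    exact Real.exp_le_exp.2 (hB a)
  refine (Finset.sum_le_sum fun v _ => Finset.sum_le_sum fun a _ => h1 v a).trans_eq ?_
  simp

theorem card_mul_exp_le {n : ℕ} {k L D η : ℝ} (hn : 0 < n) (hL : L = Real.log n) (hk : k ≤ L)
    (hLD : L ≤ D) (hη : 0 < η) (hL16 : 16 ≤ L) (hLη : -Real.log η ≤ L) :
    n * (k * Real.exp (-(D ^ 3 / 64))) ≤ η := by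
  have hn' : (n : ℝ) = Real.exp L := by
    rw [hL, Real.exp_log (by exact_mod_cast hn)]
  have hkL : k ≤ Real.exp L := by linarith [Real.add_one_le_exp L]
  have hL3 : L ^ 3 ≤ D ^ 3 := by gcongr
  -- So D^3/64 ≥ 4L, which absorbs the two factors exp L and leaves exp(-2L), at most η.
  have h4 : 256 * L ≤ L ^ 3 := by
    nlinarith [mul_nonneg (by linarith : 0 ≤ L) (by nlinarith : 0 ≤ L ^ 2 - 256)]
  calc n * (k * Real.exp (-(D ^ 3 / 64)))
      ≤ Real.exp L * (Real.exp L * Real.exp (-(D ^ 3 / 64))) := by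
        rw [hn']
        gcongr
    _ = Real.exp (L + (L + -(D ^ 3 / 64))) := by rw [Real.exp_add, Real.exp_add]
    _ ≤ Real.exp (Real.log η) := Real.exp_le_exp.2 (by linarith)
    _ = η := Real.exp_log hη

end TreeEmbedding

theorem theorem5p2 (η : ℝ) (hη : 0 < η) :
    ∃ n₀ : ℕ, ∀ (V : Type*) [Fintype V] (G : SimpleGraph V) (d k t : ℕ) (ε δ : ℝ),
      n₀ ≤ Fintype.card V →
      TreeEmbedding.PropertyP G d k t →
      Real.log (Fintype.card V) ^ 8 ≤ (d : ℝ) →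
      (k : ℝ) ≤ Real.log (Fintype.card V) →
      0 < ε → 0 < δ →
      (2 * (k : ℝ) * ε) ^ (1 / (k : ℝ)) + δ + 1 / (k : ℝ) ≤ 1 →
      ∀ (W : Type*) [Fintype W] (T : SimpleGraph W) [DecidableRel T.Adj], T.IsTree →
        (∀ w : W, (T.degree w : ℝ) ≤ δ * (d : ℝ)) →
        (Fintype.card W : ℝ) ≤ ε * (t : ℝ) →
        ∀ (r : W) (σ : TreeEmbedding.Schedule T r V) (v₀ : V),
          ENNReal.ofReal (1 - η) ≤ TreeEmbedding.successProb G σ k v₀ := by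
  classical
  refine ⟨⌈Real.exp (max 16 (-Real.log η))⌉₊, ?_⟩
  intro V _ G d k t ε δ hn hP hd hkL hε hδ hcond W _ T _ hT hdeg hW r σ v₀
  obtain ⟨par, hpar⟩ := TreeEmbedding.exists_parent hT r
  set n := Fintype.card V with hn_def
  set L := Real.log n with hL_def
  have hn0 : 0 < n := Fintype.card_pos_iff.2 ⟨v₀⟩
  have hLmax : max 16 (-Real.log η) ≤ L := by
    rw [hL_def, Real.le_log_iff_exp_le (by exact_mod_cast hn0)]
    exact (Nat.le_ceil _).trans (by exact_mod_cast hn)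
  have hL16 : 16 ≤ L := (le_max_left _ _).trans hLmax
  have hLη : -Real.log η ≤ L := (le_max_right _ _).trans hLmax
  have hd0 : (0 : ℝ) < d := by exact_mod_cast hP.d_pos
  have ht0 : (0 : ℝ) < t := by exact_mod_cast hP.t_pos
  have hk1 : (1 : ℝ) ≤ k := by exact_mod_cast hP.k_pos
  have hk0 : (0 : ℝ) < k := by linarith
  -- With D = d^(1/8) the hypotheses read log n ≤ D and at most D^2 paths of length k.
  obtain ⟨D, hD0, hD⟩ : ∃ D : ℝ, 0 < D ∧ D ^ 8 = d := by
    refine ⟨(d : ℝ) ^ ((8 : ℕ) : ℝ)⁻¹, by positivity, ?_⟩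
    exact Real.rpow_inv_natCast_pow hd0.le (by norm_num)
  have hLD : L ≤ D := by
    rw [← hD] at hd
    exact le_of_pow_le_pow_left₀ (by norm_num) hD0.le hd
  have hD16 : 16 ≤ D := hL16.trans hLD
  have hquarter : (d : ℝ) ^ (1 / 4 : ℝ) = D ^ 2 := by
    rw [← hD, ← Real.rpow_natCast, ← Real.rpow_natCast, ← Real.rpow_mul hD0.le]
    norm_num
  set N := ⌊D ^ 2⌋₊ with hN_def
  have hND : (N : ℝ) ≤ D ^ 2 := Nat.floor_le (by positivity)
  have hncard : ∀ v, d ≤ (G.neighborSet v).ncard := fun v => by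
    rw [Set.ncard_eq_toFinset_card', ← SimpleGraph.neighborFinset,
      SimpleGraph.card_neighborFinset_eq_degree]
    convert hP.le_degree v
  have hpathsk : ∀ u v, TreeEmbedding.numPaths G k u v ≤ N := fun u v => by
    rw [hN_def, ← hquarter]
    exact Nat.le_floor (hP.paths_le u v)
  have hNk : (N + 1) * (k + 1) < d := by
    have h1 : ((N : ℝ) + 1) * (k + 1) ≤ (2 * D ^ 2) * (2 * D) := by
      gcongr
      · nlinarith
      · linarith
    have h2 : (2 * D ^ 2) * (2 * D) < (d : ℝ) := by
      rw [← hD]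
      have : (4 : ℝ) < D ^ 5 := by
        calc (4 : ℝ) < 16 ^ 5 := by norm_num
          _ ≤ D ^ 5 := by gcongr
      nlinarith [pow_pos hD0 3]
    exact_mod_cast h1.trans_lt h2
  set α : ℝ := (2 * (k : ℝ) * ε) ^ (1 / (k : ℝ)) with hα
  have hα0 : 0 < α := by positivity
  have hαk : α ^ k = 2 * k * ε := by
    rw [hα, one_div]
    exact Real.rpow_inv_natCast_pow (by positivity) hP.k_pos.ne'
  -- The allowed excess over the mean in each residue class, chosen so that kN + d/(2k) + ks = d/k.
  set s : ℝ := D ^ 8 / (2 * k ^ 2) - N with hs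
  set κ : ℝ := s * k / (2 * D ^ 10) with hκ
  -- Since α^k = 2kε, this makes q(αd)^k equal to d^(k+1)/t.
  set q : ℝ := d / (2 * k * ε * t) with hq
  have hqW : q * Fintype.card W ≤ D ^ 8 / (2 * k) := by
    rw [hD]
    refine (mul_le_mul_of_nonneg_left hW (by positivity)).trans_eq ?_
    rw [hq]
    field_simp
  obtain ⟨hκ0, hκN, hexp⟩ := TreeEmbedding.exponent_bound hD16 hk1 (hkL.trans hLD)
    (Nat.cast_nonneg N) hND hs hκ
  have hctrl : TreeEmbedding.Controlled G T r par (α * d) q κ k N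
      (fun a => q * (TreeEmbedding.deepClass T r par k a).card + s) :=
    { tree := hT
      parent := hpar
      k_pos := hP.k_pos
      pos := by positivity
      q_nonneg := by positivity
      κ_nonneg := hκ0
      κ_mul_le := hκN
      paths_le := fun j hj x v => TreeEmbedding.numPaths_le_of_le hNk hncard hpathsk hj x v
      paths_succ_le := fun x v => by
        refine (hP.paths_succ_le x v).trans_eq ?_
        rw [mul_pow, hαk, hq]
        field_simp
        ring
      room := fun x u l hl hchild => by
        have h1 : (l.length : ℝ) ≤ δ * d := by
          refine le_trans ?_ (hdeg u)
          rw [← SimpleGraph.card_neighborFinset_eq_degree, ← List.toFinset_card_of_nodup hl]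
          refine Nat.cast_le.2 (Finset.card_le_card fun w hw => ?_)
          rw [SimpleGraph.mem_neighborFinset]
          exact (hchild w (List.mem_toFinset.1 hw)).1
        have h2 : ∑ a ∈ Finset.range k,
            (q * ((TreeEmbedding.deepClass T r par k a).card : ℝ) + s) ≤
            D ^ 8 / (2 * k) + k * s := by
          rw [Finset.sum_add_distrib, ← Finset.mul_sum]
          simp only [Finset.sum_const, Finset.card_range, nsmul_eq_mul]
          gcongr
          refine le_trans (mul_le_mul_of_nonneg_left ?_ (by positivity)) hqW
          exact_mod_cast TreeEmbedding.sum_card_deepClass_le T r par k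
        have h3 : k * N + (D ^ 8 / (2 * k) + k * s) = (1 / k) * (d : ℝ) := by
          rw [hs, hD]
          field_simp
          ring
        have h4 : (α + δ + 1 / k) * (d : ℝ) ≤ 1 * d := by gcongr
        have h5 : (d : ℝ) ≤ (G.neighborSet x).ncard := by exact_mod_cast hncard x
        linarith }
  refine hctrl.le_successProb σ v₀ hη.le (fun v => ?_) (fun f hf => ?_) k
  · rw [← Set.ncard_pos (Set.toFinite _)]
    exact hP.d_pos.trans_le (hncard v)
  · refine (hctrl.failureBound_le (B := -(D ^ 3 / 64)) (fun a => ?_) hf).trans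
      (TreeEmbedding.card_mul_exp_le hn0 hL_def hkL hLD hη hL16 hLη)
    refine hexp _ (by positivity) (le_trans (mul_le_mul_of_nonneg_left ?_ (by positivity)) hqW)
    exact_mod_cast Finset.card_le_univ _
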